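/- All graphs are finite and simple, and the empty graph is allowed. For a graph $G$ let $\omega(G)$ and $\alpha(G)$ be the maximum sizes of a clique and of a stable set, $\chi(G)$ the chromatic number, and $\theta(G)$ the minimum number of cliques needed to cover the vertices. Let $f,g$ denote functions from $\mathbb{N}=\{0,1,2,\dots\}$ to $\mathbb{R}$. A graph $G$ is *$\chi$-bounded by $f$* if $\chi(H)\le f(\omega(H))$ for every induced subgraph $H$ of $G$, and *$\theta$-bounded by $f$* if $\theta(H)\le f(\alpha(H))$ for every induced subgraph $H$ of $G$. A class of graphs is $\chi$-bounded (resp. $\theta$-bounded) if there is a single function by which each of its members is $\chi$-bounded (resp. $\theta$-bounded). The function $f$ is *complementary-bounded* if the class of all graphs that are $\chi$-bounded by $f$ is $\theta$-bounded (by some function $g$). For integers $n\ge 1$ and $k\ge 0$, the *Schrijver graph* $SG_{n,k}$ has as vertices the $n$-element subsets of $\{1,\dots,2n+k\}$ that contain no two neighbours in the cyclic ordering of $\{1,\dots,2n+k\}$; two distinct vertices are adjacent if and only if they are disjoint. **Theorem.** Let $h$ be a real-valued function on $\mathbb{N}$ that is non-decreasing on the positive integers, with $h(1)\ge 0$ and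 $h(n)>0$ for all $n\ge 2$, such that for every integer $k\ge 1$ we have $h(n^k)\le n/k$ for all sufficiently large integers $n$. Let $f(x)=x+x/h(x)$, where $f(0)$ is read as $0$, and $f(1)$ is read as $1$ if $h(1)=0$. Then $f$ is not complementary-bounded. Moreover, there are positive integers $N(k)$, $k=0,1,2,\dots$, such that every graph in the class $\{SG_{N(k),k} : k\ge 0\}$ is $\theta$-bounded by $f$, while the chromatic numbers of the graphs in this class are unbounded and the class is not $\chi$-bounded. -/

import Mathlib

/-- The clique cover number `θ(G)` of a finite graph: the least number of cliques
whose union is the whole vertex set. (The set below is nonempty: singletons are cliques.) -/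
noncomputable def cliqueCoverNum {V : Type} [Finite V] (G : SimpleGraph V) : ℕ :=
  sInf {n : ℕ | ∃ C : Finset (Set V),
    C.card = n ∧ (∀ K ∈ C, G.IsClique K) ∧ ∀ v : V, ∃ K ∈ C, v ∈ K}

/-- `G` is `χ`-bounded by `f`: `χ(H) ≤ f(ω(H))` for every induced subgraph `H` of `G`
(the chromatic number of a finite graph is finite, so `toNat` is its value). -/
def ChiBoundedBy {V : Type} [Finite V] (G : SimpleGraph V) (f : ℕ → ℝ) : Prop :=
  ∀ s : Set V, ((G.induce s).chromaticNumber.toNat : ℝ) ≤ f (G.induce s).cliqueNum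

/-- `G` is `θ`-bounded by `f`: `θ(H) ≤ f(α(H))` for every induced subgraph `H` of `G`. -/
def ThetaBoundedBy {V : Type} [Finite V] (G : SimpleGraph V) (f : ℕ → ℝ) : Prop :=
  ∀ s : Set V, (cliqueCoverNum (G.induce s) : ℝ) ≤ f (G.induce s).indepNum

/-- `f` is complementary-bounded: the class of all finite graphs that are `χ`-bounded by `f`
is `θ`-bounded by some function `g`. -/
def ComplementaryBounded (f : ℕ → ℝ) : Prop :=
  ∃ g : ℕ → ℝ, ∀ (V : Type) [Finite V] (G : SimpleGraph V),
    ChiBoundedBy G f → ThetaBoundedBy G g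

/-- The Kneser graph `KG_{n,k}`: its vertices are the `n`-element subsets of a set of
`2n + k` elements, and two distinct vertices are adjacent when they are disjoint. -/
def kneserGraph (n k : ℕ) : SimpleGraph {S : Finset (Fin (2 * n + k)) // S.card = n} where
  Adj S T := S ≠ T ∧ Disjoint S.1 T.1
  symm := ⟨fun _ _ h => ⟨h.1.symm, h.2.symm⟩⟩
  loopless := ⟨fun _ h => h.1 rfl⟩

/-- A subset of `Fin m` is sparse if it does not contain two neighbours in the cyclic
ordering `0, 1, …, m - 1, 0`. -/
def IsSparse {m : ℕ} (S : Finset (Fin m)) : Prop :=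
  ∀ i ∈ S, ∀ j ∈ S, (j : ℕ) ≠ ((i : ℕ) + 1) % m

/-- The Schrijver graph `SG_{n,k}`: the subgraph of `KG_{n,k}` induced by the sparse sets. -/
def schrijverGraph (n k : ℕ) :
    SimpleGraph {S : {S : Finset (Fin (2 * n + k)) // S.card = n} | IsSparse S.1} :=
  (kneserGraph n k).induce _

/-! Walking once around the cycle, an `n`-element sparse set in `2n + k` points has exactly `k`
gaps, that is, neighbouring pairs it misses. For each pair `i, i + 1`, the vertices containing `i`
and those containing `i + 1` form two stable sets, and the rest have a gap there. Averaging over `i`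
in an induced subgraph with stability number `α`, some rest has at most `kα/n` vertices; König's
theorem covers the two stable sets by at most `α` cliques, so `θ ≤ (1 + k/n)α`
(`mul_cliqueCoverNum_induce_schrijverGraph_le`). There are at most `n ^ (2k + 1)` vertices, so the
growth condition gives `k/n ≤ 1/h(α)` once `n` is large and `h(α) > 0`.

On the other side, `χ ≥ k + 2` (`le_chromaticNumber_schrijverGraph`), while `ω ≤ 2` when `k < n`.
Thus no function χ-bounds the class, and the complements show that `f` is not complementary-bounded.

The bound on `χ` rests on a mod 2 Tucker lemma (`exists_alternating_flag`), proved by counting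
alternating flags in the barycentric subdivision of a cross-polytope by induction on dimension. -/

open Finset
/-! ### Flags of faces of a simplex, modulo two -/

section Flags

variable {E : Type*} [DecidableEq E]

/-- The sum of `φ` over all flags `[X, X \ {e₁}, X \ {e₁, e₂}, …]` with `d` members. -/
def flagSum : ℕ → Finset E → (List (Finset E) → ZMod 2) → ZMod 2
  | 0, _, φ => φ []
  | d + 1, X, φ => ∑ e ∈ X, flagSum d (X.erase e) (fun l => φ (X :: l))

/-- The simplicial coboundary modulo two, on functions of ordered simplices. -/
def coboundary {α : Type*} : (List α → ZMod 2) → List α → ZMod 2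
  | _, [] => 0
  | φ, x :: l => φ l + coboundary (fun l => φ (x :: l)) l

theorem flagSum_add (d : ℕ) (X : Finset E) (φ ψ : List (Finset E) → ZMod 2) :
    flagSum d X (fun l => φ l + ψ l) = flagSum d X φ + flagSum d X ψ := by
  induction d generalizing X φ ψ with
  | zero => rfl
  | succ d ih => simp only [flagSum, ih, sum_add_distrib]

/-- A list of faces is a flag of `X` if it is decreasing, consists of nonempty subsets of `X`,
and has as many members as `X` has elements. -/
structure IsFlag (X : Finset E) (l : List (Finset E)) : Prop where
  subset : ∀ A ∈ l, A ⊆ X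
  nonempty : ∀ A ∈ l, A.Nonempty
  pairwise : l.Pairwise (fun A B => B ⊆ A)
  length : l.length = X.card

theorem flagSum_congr {d : ℕ} {X : Finset E} (hX : X.card = d) {φ ψ : List (Finset E) → ZMod 2}
    (h : ∀ l, IsFlag X l → φ l = ψ l) : flagSum d X φ = flagSum d X ψ := by
  induction d generalizing X φ ψ with
  | zero => exact h [] ⟨by simp, by simp, by simp, by simp [hX]⟩
  | succ d ih =>
    refine sum_congr rfl fun e he => ih (by rw [card_erase_of_mem he, hX]; rfl) fun l hl => h _ ?_
    refine ⟨?_, ?_, ?_, ?_⟩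
    · rintro A (_ | ⟨_, hA⟩)
      · exact Subset.rfl
      · exact (hl.subset A hA).trans (erase_subset _ _)
    · rintro A (_ | ⟨_, hA⟩)
      · exact ⟨e, he⟩
      · exact hl.nonempty A hA
    · exact List.pairwise_cons.2 ⟨fun A hA => (hl.subset A hA).trans (erase_subset _ _), hl.pairwise⟩
    · rw [List.length_cons, hl.length, card_erase_of_mem he, hX]; rfl

theorem flagSum_zero (d : ℕ) (X : Finset E) : flagSum d X (fun _ => 0) = 0 := by
  induction d generalizing X with
  | zero => rfl
  | succ d ih => simp [flagSum, ih]

theorem exists_isFlag_of_flagSum_ne_zero {d : ℕ} {X : Finset E} (hX : X.card = d)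
    {φ : List (Finset E) → ZMod 2} (h : flagSum d X φ ≠ 0) : ∃ l, IsFlag X l ∧ φ l ≠ 0 := by
  by_contra! H
  exact h ((flagSum_congr hX H).trans (flagSum_zero d X))

theorem flagSum_map {E' : Type*} [DecidableEq E'] (ν : E ↪ E') (d : ℕ) (X : Finset E)
    (φ : List (Finset E') → ZMod 2) :
    flagSum d (X.map ν) φ = flagSum d X (fun l => φ (l.map (Finset.map ν))) := by
  induction d generalizing X φ with
  | zero => rfl
  | succ d ih =>
    simp only [flagSum, sum_map, ← map_erase, ih, List.map_cons]

theorem sum_sum_erase_eq_zero (X : Finset E) (F : E → E → ZMod 2) (hF : ∀ a b, F a b = F b a) :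
    ∑ a ∈ X, ∑ b ∈ X.erase a, F a b = 0 := by
  rw [sum_sigma']
  refine sum_involution (fun p _ => ⟨p.2, p.1⟩) ?_ ?_ ?_ ?_
  · rintro ⟨a, b⟩ _
    simp only [hF b a, CharTwo.add_self_eq_zero]
  · rintro ⟨a, b⟩ h _ h'
    simp only [mem_sigma, mem_erase] at h
    simp only [Sigma.mk.injEq] at h'
    exact h.2.1 h'.1
  · rintro ⟨a, b⟩ h
    simp only [mem_sigma, mem_erase] at h ⊢
    exact ⟨h.2.2, h.2.1.symm, h.1⟩
  · rintro ⟨a, b⟩ _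
    rfl

/-- The boundary of a barycentrically subdivided simplex is the subdivision of its boundary. -/
theorem flagSum_coboundary (d : ℕ) (X : Finset E) (φ : List (Finset E) → ZMod 2) :
    flagSum (d + 1) X (coboundary φ) = ∑ e ∈ X, flagSum d (X.erase e) φ := by
  induction d generalizing X φ with
  | zero => simp [flagSum, coboundary]
  | succ d ih =>
    rw [flagSum]
    simp only [coboundary, flagSum_add, sum_add_distrib, ih]
    -- Deletions below the top face `X` contribute flags that remove two elements at once; each pair
    -- is removed in both orders, so these cancel.
    rw [sum_sum_erase_eq_zero, add_zero]
    intro a b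
    rw [erase_right_comm]

end Flags

/-! ### Alternating flags of the cross-polytope -/

/-- The indicator of the lists of signs that alternate and start with `b`. -/
def altIndicator : Bool → List Bool → ZMod 2
  | _, [] => 1
  | b, x :: l => if x = b then altIndicator (!b) l else 0

/-- An alternating list has exactly one deletion that is alternating with first sign `b` (or empty):
drop its last entry if it starts with `b`, its first entry otherwise. With a single repeated
neighbour, the good deletions are both copies or none; with more repetitions there are none. -/
theorem coboundary_altIndicator (b : Bool) {l : List Bool} (hl : l ≠ []) :
    coboundary (altIndicator b) l = altIndicator true l + altIndicator false l := by
  have key : ∀ (l : List Bool) (b : Bool), l ≠ [] →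
      coboundary (altIndicator b) l = altIndicator b l + altIndicator (!b) l := by
    intro l
    induction l with
    | nil => intro b h; exact absurd rfl h
    | cons x l ih =>
      intro b _
      have hz : ∀ l : List Bool, coboundary (fun _ => 0) l = 0 := by
        intro l
        induction l with
        | nil => rfl
        | cons _ _ ih => simp [coboundary, ih]
      by_cases hx : x = b
      · subst hx
        have h1 : (fun l => altIndicator x (x :: l)) = altIndicator (!x) := by
          ext l; simp [altIndicator]
        rw [coboundary, h1]
        rcases eq_or_ne l [] with rfl | hl
        · cases x <;> simp [coboundary, altIndicator]
        · rw [ih _ hl]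
          cases x <;> simp only [altIndicator, Bool.not_true, Bool.not_false, if_true] <;>
            simp <;> linear_combination CharTwo.add_self_eq_zero (altIndicator _ l)
      · have h1 : (fun l => altIndicator b (x :: l)) = fun _ => 0 := by
          ext l; simp [altIndicator, hx]
        rw [coboundary, h1, hz]
        cases x <;> cases b <;> simp_all [altIndicator]
  rw [key l b hl]
  cases b
  · exact add_comm _ _
  · rfl

theorem altIndicator_not (b : Bool) (l : List Bool) :
    altIndicator b (l.map (!·)) = altIndicator (!b) l := by
  induction l generalizing b with
  | nil => rfl
  | cons x l ih => simp only [List.map_cons, altIndicator, ih]; cases x <;> cases b <;> simp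

theorem isChain_of_altIndicator_ne_zero {b : Bool} {l : List Bool} (h : altIndicator b l ≠ 0) :
    l.IsChain (· ≠ ·) := by
  induction l generalizing b with
  | nil => simp
  | cons x l ih =>
    have hx : x = b := by by_contra hx; simp [altIndicator, hx] at h
    subst hx
    simp only [altIndicator, if_true] at h
    cases l with
    | nil => simp
    | cons y l =>
      refine List.isChain_cons_cons.2 ⟨?_, ih h⟩
      have hy : y = !x := by by_contra hy; simp [altIndicator, hy] at h
      cases x <;> simp [hy]

theorem coboundary_map {α β : Type*} (w : α → β) (φ : List β → ZMod 2) (l : List α) :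
    coboundary (fun l => φ (l.map w)) l = coboundary φ (l.map w) := by
  induction l generalizing φ with
  | nil => rfl
  | cons x l ih => simp only [List.map_cons, coboundary, ih (fun l => φ (w x :: l))]

/-- The reversal of all signs. -/
def flipSign : ℕ × Bool ↪ ℕ × Bool where
  toFun p := (p.1, !p.2)
  inj' := by rintro ⟨a, b⟩ ⟨c, d⟩ h; simpa using h

theorem mem_map_flipSign {X : Finset (ℕ × Bool)} {a : ℕ} {b : Bool} :
    (a, b) ∈ X.map flipSign ↔ (a, !b) ∈ X := by
  rw [mem_map]
  constructor
  · rintro ⟨⟨a', b'⟩, h, he⟩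
    obtain ⟨rfl, rfl⟩ := Prod.mk.inj he
    simpa using h
  · exact fun h => ⟨(a, !b), h, Prod.ext rfl (Bool.not_not b)⟩

/-- A set of signed coordinates below `m` is consistent if no coordinate occurs with both signs. -/
structure IsConsistent (m : ℕ) (X : Finset (ℕ × Bool)) : Prop where
  lt : ∀ p ∈ X, p.1 < m
  notMem : ∀ i, (i, true) ∈ X → (i, false) ∉ X

/-- The facet of the `i`-dimensional cross-polytope whose positive coordinates form `T`. -/
def signedFace (T : Finset ℕ) (i : ℕ) : Finset (ℕ × Bool) :=
  (range i).image fun j => (j, decide (j ∈ T))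

theorem mem_signedFace {T : Finset ℕ} {i : ℕ} {p : ℕ × Bool} :
    p ∈ signedFace T i ↔ p.1 < i ∧ p.2 = decide (p.1 ∈ T) := by
  rcases p with ⟨a, b⟩
  simp only [signedFace, mem_image, mem_range, Prod.mk.injEq]
  constructor
  · rintro ⟨j, hj, rfl, rfl⟩; exact ⟨hj, rfl⟩
  · rintro ⟨h, h'⟩; exact ⟨a, h, rfl, h'.symm⟩

theorem card_signedFace (T : Finset ℕ) (i : ℕ) : (signedFace T i).card = i := by
  rw [signedFace, card_image_of_injective _ fun a b h => (Prod.mk.inj h).1, card_range]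

theorem notMem_signedFace (T : Finset ℕ) (i : ℕ) (b : Bool) : (i, b) ∉ signedFace T i := by
  simp [mem_signedFace]

theorem IsConsistent.subset {m : ℕ} {X Y : Finset (ℕ × Bool)} (hY : IsConsistent m Y)
    (h : X ⊆ Y) : IsConsistent m X :=
  ⟨fun p hp => hY.lt p (h hp), fun i h1 h2 => hY.notMem i (h h1) (h h2)⟩

theorem isConsistent_signedFace (T : Finset ℕ) (i : ℕ) : IsConsistent i (signedFace T i) := by
  refine ⟨fun p hp => (mem_signedFace.1 hp).1, fun j h1 h2 => ?_⟩
  rw [mem_signedFace] at h1 h2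
  exact absurd (h1.2.trans h2.2.symm) (by simp)

theorem isConsistent_insert_signedFace (T : Finset ℕ) {i m : ℕ} (hi : i < m) (b : Bool) :
    IsConsistent m (insert (i, b) (signedFace T i)) := by
  refine ⟨fun p hp => ?_, fun j h1 h2 => ?_⟩
  · rcases mem_insert.1 hp with rfl | hp
    · exact hi
    · exact (mem_signedFace.1 hp).1.trans hi
  simp only [mem_insert, mem_signedFace, Prod.mk.injEq] at h1 h2
  rcases h1 with ⟨rfl, rfl⟩ | ⟨h1, h1'⟩ <;> rcases h2 with ⟨h3, h4⟩ | ⟨h2, h2'⟩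
  · simp at h4
  · omega
  · omega
  · exact absurd (h1'.trans h2'.symm) (by simp)

/-- The sum over all maximal flags of faces of the `i`-dimensional cross-polytope. -/
def sphereSum (i : ℕ) (φ : List (Finset (ℕ × Bool)) → ZMod 2) : ZMod 2 :=
  ∑ T ∈ (range i).powerset, flagSum i (signedFace T i) φ

/-- The sum over the maximal flags of faces of one hemisphere of the cross-polytope. -/
def hemisphereSum (b : Bool) (i : ℕ) (φ : List (Finset (ℕ × Bool)) → ZMod 2) : ZMod 2 :=
  ∑ T ∈ (range i).powerset, flagSum (i + 1) (insert (i, b) (signedFace T i)) φ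

theorem sphereSum_succ (i : ℕ) (φ : List (Finset (ℕ × Bool)) → ZMod 2) :
    sphereSum (i + 1) φ = hemisphereSum true i φ + hemisphereSum false i φ := by
  rw [sphereSum, range_add_one, sum_powerset_insert (by simp), add_comm, hemisphereSum,
    hemisphereSum]
  congr 1 <;> refine sum_congr rfl fun T hT => ?_ <;> congr 1 <;> ext ⟨a, b⟩ <;>
    simp only [mem_signedFace, mem_insert, Prod.mk.injEq] <;>
    have hi : i ∉ T := fun h => by simpa using mem_powerset.1 hT h
  · rcases eq_or_ne a i with rfl | h
    · simp
    · have : a < i + 1 ↔ a < i := by omega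
      simp [h, this]
  · rcases eq_or_ne a i with rfl | h
    · simp [hi]
    · have : a < i + 1 ↔ a < i := by omega
      simp [h, this]

/-- Omitting the apex `(i, b)` from a facet leaves a facet of the equator. A face omitting a
coordinate `j < i` lies in two facets, differing in the sign of `j`, and cancels. -/
theorem hemisphereSum_coboundary (b : Bool) (i : ℕ) (φ : List (Finset (ℕ × Bool)) → ZMod 2) :
    hemisphereSum b i (coboundary φ) = sphereSum i φ := by
  simp only [hemisphereSum, flagSum_coboundary, sum_insert (notMem_signedFace _ i b),
    erase_insert (notMem_signedFace _ i b), sum_add_distrib]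
  rw [sphereSum, add_eq_left]
  have : ∀ T, ∑ e ∈ signedFace T i, flagSum i ((insert (i, b) (signedFace T i)).erase e) φ =
      ∑ j ∈ range i, flagSum i ((insert (i, b) (signedFace T i)).erase (j, decide (j ∈ T))) φ := by
    intro T
    exact sum_image fun x _ y _ h => (Prod.mk.inj h).1
  simp only [this]
  rw [sum_comm]
  refine sum_eq_zero fun j hj => ?_
  have hji : j ≠ i := (mem_range.1 hj).ne
  refine sum_involution (fun T _ => symmDiff T {j}) ?_ ?_ ?_ ?_
  · intro T _
    have : (insert (i, b) (signedFace (symmDiff T {j}) i)).erase (j, decide (j ∈ symmDiff T {j})) =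
        (insert (i, b) (signedFace T i)).erase (j, decide (j ∈ T)) := by
      ext ⟨a, c⟩
      rcases eq_or_ne a j with rfl | h
      · simp only [mem_erase, mem_insert, mem_signedFace, Prod.mk.injEq, hji, false_and,
          false_or, ne_eq]
        tauto
      · simp [mem_erase, mem_insert, mem_signedFace, h, mem_symmDiff]
    rw [this, CharTwo.add_self_eq_zero]
  · intro T _ _ h
    have := symmDiff_eq_left.1 h
    simp at this
  · intro T hT
    rw [mem_powerset] at hT ⊢
    intro a ha
    rcases mem_symmDiff.1 ha with h | h
    · exact hT h.1
    · rw [mem_singleton.1 h.1]; exact hj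
  · intro T _
    rw [symmDiff_assoc, symmDiff_self, symmDiff_bot]

theorem hemisphereSum_false (i : ℕ) (φ : List (Finset (ℕ × Bool)) → ZMod 2) :
    hemisphereSum false i φ = hemisphereSum true i fun l => φ (l.map (Finset.map flipSign)) := by
  rw [hemisphereSum, hemisphereSum]
  refine sum_nbij' (fun T => range i \ T) (fun T => range i \ T) ?_ ?_ ?_ ?_ ?_
  · intro T _; simp
  · intro T _; simp
  · intro T hT; simpa using mem_powerset.1 hT
  · intro T hT; simpa using mem_powerset.1 hT
  · intro T hT
    rw [← flagSum_map]
    congr 1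
    ext ⟨a, b⟩
    simp only [mem_map_flipSign, mem_insert, mem_signedFace, Prod.mk.injEq, mem_sdiff, mem_range]
    by_cases h : a < i <;> by_cases h' : a ∈ T <;> cases b <;> simp [h, h']

/-- An antipodal choice of signs for the proper faces of the cross-polytope alternates along an odd
number of maximal flags that start with a positive sign. -/
theorem sphereSum_altIndicator {m : ℕ} (w : Finset (ℕ × Bool) → Bool)
    (hw : ∀ X, X.Nonempty → IsConsistent m X → w (X.map flipSign) = !w X) {i : ℕ} (hi : i ≤ m) :
    sphereSum i (fun l => altIndicator true (l.map w)) = 1 := by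
  induction i with
  | zero => simp [sphereSum, flagSum, altIndicator]
  | succ i ih =>
    -- By antipodality, positive-start flags in the lower hemisphere are negative-start flags in the
    -- upper one, so the total is the sum of the coboundary of `altIndicator true` over the upper
    -- hemisphere, hence the sum over the equator.
    rw [← ih (by omega), sphereSum_succ, hemisphereSum_false, ← hemisphereSum_coboundary true i]
    simp only [hemisphereSum, ← sum_add_distrib, ← flagSum_add]
    refine sum_congr rfl fun T _ => ?_
    have hcard : (insert (i, true) (signedFace T i)).card = i + 1 := by
      rw [card_insert_of_notMem (notMem_signedFace _ _ _), card_signedFace]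
    refine flagSum_congr hcard fun l hl => ?_
    have hne : l.map w ≠ [] := by
      intro h
      have := hl.length
      rw [List.map_eq_nil_iff.1 h, hcard] at this
      simp at this
    rw [coboundary_map w (altIndicator true), coboundary_altIndicator _ hne]
    congr 1
    rw [← Bool.not_true, ← altIndicator_not, List.map_map, List.map_map]
    congr 1
    refine List.map_congr_left fun A hA => ?_
    exact hw A (hl.nonempty A hA)
      ((isConsistent_insert_signedFace T hi true).subset (hl.subset A hA))

/-- A form of the octahedral Tucker lemma. -/
theorem exists_alternating_flag {m : ℕ} (w : Finset (ℕ × Bool) → Bool)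
    (hw : ∀ X, X.Nonempty → IsConsistent m X → w (X.map flipSign) = !w X) :
    ∃ T l, IsFlag (signedFace T m) l ∧ (l.map w).IsChain (· ≠ ·) := by
  have h : sphereSum m (fun l => altIndicator true (l.map w)) ≠ 0 := by
    rw [sphereSum_altIndicator w hw le_rfl]; exact one_ne_zero
  obtain ⟨T, _, hT⟩ := exists_ne_zero_of_sum_ne_zero h
  obtain ⟨l, hl, hne⟩ := exists_isFlag_of_flagSum_ne_zero (card_signedFace T m) hT
  exact ⟨T, l, hl, isChain_of_altIndicator_ne_zero hne⟩

/-! ### The chromatic number of Schrijver graphs -/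

/-- If a monotone antipodal family of signed predicates `Q v`, `1 ≤ v ≤ M`, has no largest index
at which both signs hold, then the dimension of the cross-polytope is at most `M`. -/
theorem le_of_monotone_labelling {m M : ℕ} (Q : ℕ → Bool → Finset (ℕ × Bool) → Prop)
    (mono : ∀ v b X Y, X ⊆ Y → Q v b X → Q v b Y)
    (flip : ∀ v b X, Q v b X → Q v (!b) (X.map flipSign))
    (bound : ∀ v b X, Q v b X → 1 ≤ v ∧ v ≤ M)
    (total : ∀ X, X.Nonempty → IsConsistent m X → ∃ v b, Q v b X)
    (sep : ∀ X v, IsConsistent m X → Q v true X → Q v false X → ∃ v' b, v < v' ∧ Q v' b X) :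
    m ≤ M := by
  classical
  -- Each face receives the largest index it satisfies, and `w` records the sign, which `sep` makes
  -- unique.
  let val : Finset (ℕ × Bool) → ℕ := fun X => Nat.findGreatest (fun v => ∃ b, Q v b X) M
  let w : Finset (ℕ × Bool) → Bool := fun X => decide (Q (val X) true X)
  have le_val : ∀ v b X, Q v b X → v ≤ val X := fun v b X h =>
    Nat.le_findGreatest (bound v b X h).2 ⟨b, h⟩
  have val_spec : ∀ X, X.Nonempty → IsConsistent m X → ∃ b, Q (val X) b X := by
    intro X hX hc
    obtain ⟨v, b, h⟩ := total X hX hc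
    exact Nat.findGreatest_spec (P := fun v => ∃ b, Q v b X) (bound v b X h).2 ⟨b, h⟩
  have not_both : ∀ X, IsConsistent m X → ¬ (Q (val X) true X ∧ Q (val X) false X) := by
    rintro X hc ⟨h1, h2⟩
    obtain ⟨v', b, hlt, h⟩ := sep X _ hc h1 h2
    exact absurd (le_val _ _ _ h) (by omega)
  have flip' : ∀ v b X, Q v b (X.map flipSign) → Q v (!b) X := by
    intro v b X h
    have : (X.map flipSign).map flipSign = X := by
      ext ⟨a, c⟩
      rw [mem_map_flipSign, mem_map_flipSign, Bool.not_not]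
    simpa [this] using flip v b _ h
  have val_flip : ∀ X, val (X.map flipSign) = val X := by
    intro X
    simp only [val]
    congr 1
    ext v
    exact ⟨fun ⟨b, h⟩ => ⟨_, flip' v b X h⟩, fun ⟨b, h⟩ => ⟨_, flip v b X h⟩⟩
  have w_spec : ∀ X, X.Nonempty → IsConsistent m X → ∀ b, Q (val X) b X → w X = b := by
    intro X hX hc b hb
    cases b
    · simp only [w, decide_eq_false_iff_not]
      exact fun h => not_both X hc ⟨h, hb⟩
    · simpa [w] using hb
  have hw : ∀ X, X.Nonempty → IsConsistent m X → w (X.map flipSign) = !w X := by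
    intro X hX hc
    obtain ⟨b, hb⟩ := val_spec X hX hc
    have hc' : IsConsistent m (X.map flipSign) := by
      refine ⟨fun p hp => ?_, fun i h1 h2 => ?_⟩
      · exact hc.lt (p.1, !p.2) (mem_map_flipSign.1 hp)
      · exact hc.notMem i (mem_map_flipSign.1 h2) (mem_map_flipSign.1 h1)
    rw [w_spec X hX hc b hb, w_spec _ (hX.map) hc' (!b) (by rw [val_flip]; exact flip _ _ _ hb)]
  obtain ⟨T, l, hl, hch⟩ := exists_alternating_flag w hw
  have hcons : ∀ A ∈ l, IsConsistent m A := fun A hA =>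
    (isConsistent_signedFace T m).subset (hl.subset A hA)
  -- Monotonicity passes the label of `B` to `A`, so equal values would force equal signs. An
  -- alternating flag therefore has `m` distinct values in `[1, M]`.
  have hlt : ∀ A ∈ l, ∀ B ∈ l, B ⊆ A → w A ≠ w B → val B < val A := by
    intro A hA B hB hBA hne
    obtain ⟨b, hb⟩ := val_spec B (hl.nonempty B hB) (hcons B hB)
    have hbA := mono _ _ _ _ hBA hb
    refine lt_of_le_of_ne (le_val _ _ _ hbA) fun h => hne ?_
    rw [w_spec B (hl.nonempty B hB) (hcons B hB) b hb,
      w_spec A (hl.nonempty A hA) (hcons A hA) b (h ▸ hbA)]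
  have hch' : (l.map val).IsChain (· > ·) := by
    rw [List.isChain_iff_getElem] at hch ⊢
    intro i hi
    have hi' : i + 1 < l.length := by simpa using hi
    have h1 := hch i (by simpa using hi)
    simp only [List.getElem_map] at h1 ⊢
    exact hlt _ (List.getElem_mem _) _ (List.getElem_mem _)
      (List.pairwise_iff_getElem.1 hl.pairwise _ _ _ _ (Nat.lt_succ_self i)) h1
  have hnd : (l.map val).Nodup := hch'.pairwise.imp fun h => ne_of_gt h
  have hsub : (l.map val).toFinset ⊆ Icc 1 M := by
    intro v hv
    simp only [List.mem_toFinset, List.mem_map] at hv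
    obtain ⟨A, hA, rfl⟩ := hv
    obtain ⟨b, hb⟩ := val_spec A (hl.nonempty A hA) (hcons A hA)
    exact mem_Icc.2 (bound _ _ _ hb)
  have := card_le_card hsub
  rw [List.toFinset_card_of_nodup hnd, List.length_map, hl.length, card_signedFace,
    Nat.card_Icc] at this
  omega

/-- `X` contains an alternating sequence of length `t` that starts with the sign `b`. -/
def HasAlternating (t : ℕ) (b : Bool) (X : Finset (ℕ × Bool)) : Prop :=
  ∃ g : ℕ → ℕ, StrictMono g ∧ ∀ j < t, (g j, b ^^ decide (j % 2 = 1)) ∈ X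

theorem HasAlternating.cons {t : ℕ} {b : Bool} {X : Finset (ℕ × Bool)} {g : ℕ → ℕ}
    (hg : StrictMono g) (h : ∀ j < t, (g j, (!b) ^^ decide (j % 2 = 1)) ∈ X) {i : ℕ}
    (hi : i < g 0) (hX : (i, b) ∈ X) : HasAlternating (t + 1) b X := by
  refine ⟨fun j => Nat.casesOn j i g, ?_, ?_⟩
  · refine strictMono_nat_of_lt_succ fun j => ?_
    cases j with
    | zero => exact hi
    | succ j => exact hg (Nat.lt_succ_self j)
  · intro j hj
    cases j with
    | zero => simpa using hX
    | succ j =>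
      convert h j (by omega) using 2
      rcases Nat.mod_two_eq_zero_or_one j with h2 | h2
      · have : (j + 1) % 2 = 1 := by omega
        simp [h2, this]
      · have : (j + 1) % 2 = 0 := by omega
        simp [h2, this]

/-- Consistency makes the two first coordinates differ; the earlier one can be put in front of the
other sequence. -/
theorem HasAlternating.exists_succ {m t : ℕ} (ht : 1 ≤ t) {X : Finset (ℕ × Bool)}
    (hX : IsConsistent m X) (h1 : HasAlternating t true X) (h2 : HasAlternating t false X) :
    ∃ b, HasAlternating (t + 1) b X := by
  obtain ⟨g, hg, hgX⟩ := h1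
  obtain ⟨g', hg', hgX'⟩ := h2
  have e1 : (g 0, true) ∈ X := by simpa using hgX 0 ht
  have e2 : (g' 0, false) ∈ X := by simpa using hgX' 0 ht
  rcases lt_trichotomy (g 0) (g' 0) with h | h | h
  · exact ⟨true, .cons hg' hgX' h e1⟩
  · rw [← h] at e2
    exact absurd e2 (hX.notMem _ e1)
  · exact ⟨false, .cons hg hgX h e2⟩

/-- Take the `n` terms of sign `c`. Terms of the other sign separate them, and one also lies either
before the first or after the last, which handles the cyclic wrap. -/
theorem HasAlternating.exists_sparse {n k : ℕ} {b : Bool} {X : Finset (ℕ × Bool)}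
    (hX : IsConsistent (2 * n + k) X) (h : HasAlternating (2 * n) b X) (c : Bool) :
    ∃ S : {S : {S : Finset (Fin (2 * n + k)) // S.card = n} | IsSparse S.1},
      ∀ i ∈ S.1.1, ((i : ℕ), c) ∈ X := by
  obtain ⟨g, hg, hgX⟩ := h
  have hlt : ∀ j < 2 * n, g j < 2 * n + k := fun j hj => hX.lt _ (hgX j hj)
  obtain ⟨e, he, hec⟩ : ∃ e < 2, (b ^^ decide (e % 2 = 1)) = c := by
    cases b <;> cases c
    exacts [⟨0, by simp⟩, ⟨1, by simp⟩, ⟨1, by simp⟩, ⟨0, by simp⟩]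
  let f : Fin n → Fin (2 * n + k) := fun j => ⟨g (2 * j + e), hlt _ (by omega)⟩
  have hf : Function.Injective f := by
    intro x y hxy
    have : 2 * (x : ℕ) + e = 2 * y + e := hg.injective (Fin.mk.inj hxy)
    ext; omega
  refine ⟨⟨⟨univ.image f, by rw [card_image_of_injective _ hf, card_univ, Fintype.card_fin]⟩, ?_⟩, ?_⟩
  · intro i hi j hj
    simp only [mem_image, mem_univ, true_and] at hi hj
    obtain ⟨x, rfl⟩ := hi
    obtain ⟨y, rfl⟩ := hj
    simp only [f]
    intro heq
    have hx := hlt (2 * x + e) (by omega)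
    rcases Nat.lt_or_ge (g (2 * x + e) + 1) (2 * n + k) with h' | h'
    · rw [Nat.mod_eq_of_lt h'] at heq
      have h1 : 2 * (x : ℕ) + e < 2 * y + e := hg.lt_iff_lt.1 (by omega)
      have h2 : g (2 * x + e) < g (2 * x + e + 1) := hg (by omega)
      have h3 : g (2 * x + e + 1) < g (2 * y + e) := hg (by omega)
      omega
    · have : g (2 * x + e) + 1 = 2 * n + k := by omega
      rw [this, Nat.mod_self] at heq
      have h0 : 2 * (y : ℕ) + e = 0 := by
        by_contra h0
        have : g 0 < g (2 * y + e) := hg (by omega)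
        omega
      have h1 : g (2 * x + e) < g (2 * x + e + 1) := hg (by omega)
      have h2 := hlt (2 * x + e + 1) (by omega)
      omega
  · intro i hi
    simp only [mem_image, mem_univ, true_and] at hi
    obtain ⟨x, rfl⟩ := hi
    have := hgX (2 * x + e) (by omega)
    rw [show (2 * (x : ℕ) + e) % 2 = e % 2 by omega, hec] at this
    exact this

theorem schrijverGraph_adj_of_subset {n k : ℕ} (hn : 1 ≤ n) {X : Finset (ℕ × Bool)}
    (hX : IsConsistent (2 * n + k) X)
    {S T : {S : {S : Finset (Fin (2 * n + k)) // S.card = n} | IsSparse S.1}}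
    (hS : ∀ i ∈ S.1.1, ((i : ℕ), true) ∈ X) (hT : ∀ i ∈ T.1.1, ((i : ℕ), false) ∈ X) :
    (schrijverGraph n k).Adj S T := by
  have hd : Disjoint S.1.1 T.1.1 := disjoint_left.2 fun i h1 h2 => hX.notMem _ (hS i h1) (hT i h2)
  refine ⟨fun h => ?_, hd⟩
  have hne : S.1.1.Nonempty := card_pos.1 (by rw [S.1.2]; omega)
  rw [show S.1.1 = T.1.1 from congrArg Subtype.val h] at hd hne
  exact hne.ne_empty (disjoint_self_iff_empty _ |>.1 hd)

/-- Schrijver's theorem (the lower bound). -/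
theorem le_chromaticNumber_schrijverGraph {n : ℕ} (hn : 1 ≤ n) (k : ℕ) :
    ((k + 2 : ℕ) : ℕ∞) ≤ (schrijverGraph n k).chromaticNumber := by
  rw [SimpleGraph.le_chromaticNumber_iff_coloring]
  intro r C
  -- Indices below `2n` measure alternating length; those from `2n` on encode the nonzero colours of
  -- vertices whose elements all carry sign `b` in `X`. Dropping colour `0` makes the largest index
  -- `2n + r - 2`, giving exactly `k + 2 ≤ r`.
  let Q : ℕ → Bool → Finset (ℕ × Bool) → Prop := fun v b X =>
    1 ≤ v ∧ ((v ≤ 2 * n - 1 ∧ HasAlternating v b X) ∨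
      (2 * n ≤ v ∧ ∃ S, 2 * n - 1 + (C S : ℕ) = v ∧ ∀ i ∈ S.1.1, ((i : ℕ), b) ∈ X))
  have key : 2 * n + k ≤ max (2 * n - 1) (2 * n - 1 + (r - 1)) := by
    refine le_of_monotone_labelling Q ?_ ?_ ?_ ?_ ?_
    · rintro v b X Y hXY ⟨hv, ⟨h1, g, hg, hgX⟩ | ⟨h1, S, hS, h2⟩⟩
      · exact ⟨hv, Or.inl ⟨h1, g, hg, fun j hj => hXY (hgX j hj)⟩⟩
      · exact ⟨hv, Or.inr ⟨h1, S, hS, fun i hi => hXY (h2 i hi)⟩⟩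
    · have hflip : ∀ (a : ℕ) (b : Bool) (X : Finset (ℕ × Bool)), (a, b) ∈ X → (a, !b) ∈ X.map flipSign :=
        fun a b X h => mem_map_flipSign.2 (by simpa using h)
      rintro v b X ⟨hv, ⟨h1, g, hg, hgX⟩ | ⟨h1, S, hS, h2⟩⟩
      · refine ⟨hv, Or.inl ⟨h1, g, hg, fun j hj => ?_⟩⟩
        rw [Bool.not_xor]
        exact hflip _ _ _ (hgX j hj)
      · exact ⟨hv, Or.inr ⟨h1, S, hS, fun i hi => hflip _ _ _ (h2 i hi)⟩⟩
    · rintro v b X ⟨hv, ⟨h1, -⟩ | ⟨h1, S, hS, -⟩⟩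
      · exact ⟨hv, le_max_of_le_left h1⟩
      · have := (C S).isLt
        exact ⟨hv, le_max_of_le_right (by omega)⟩
    · rintro X ⟨⟨a, b⟩, hX⟩ hc
      refine ⟨1, b, le_rfl, Or.inl ⟨by omega, fun j => a + j, fun x y h => by simpa using h, ?_⟩⟩
      intro j hj
      obtain rfl : j = 0 := by omega
      simpa using hX
    · rintro X v hc ⟨hv, ⟨h1, h2⟩ | ⟨h1, S, hS, h2⟩⟩ ⟨-, ⟨h1', h2'⟩ | ⟨h1', T, hT, h2'⟩⟩
      · obtain ⟨b, hb⟩ := HasAlternating.exists_succ hv hc h2 h2'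
        rcases h1.lt_or_eq with hlt | heq
        · exact ⟨v + 1, b, by omega, by omega, Or.inl ⟨by omega, hb⟩⟩
        -- An alternating sequence of length `2n` yields two adjacent vertices of opposite signs; at
        -- least one has a nonzero colour and so a larger index.
        · rw [show v + 1 = 2 * n by omega] at hb
          obtain ⟨S, hS⟩ := hb.exists_sparse hc true
          obtain ⟨T, hT⟩ := hb.exists_sparse hc false
          have hne := C.valid (schrijverGraph_adj_of_subset hn hc hS hT)
          rcases Nat.eq_zero_or_pos (C S : ℕ) with h0 | h0
          · have : 0 < (C T : ℕ) := Nat.pos_of_ne_zero fun h => hne (Fin.ext (h0.trans h.symm))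
            exact ⟨2 * n - 1 + C T, false, by omega, by omega, Or.inr ⟨by omega, T, rfl, hT⟩⟩
          · exact ⟨2 * n - 1 + C S, true, by omega, by omega, Or.inr ⟨by omega, S, rfl, hS⟩⟩
      · omega
      · omega
      · exact absurd (Fin.ext (by omega)) (C.valid (schrijverGraph_adj_of_subset hn hc h2 h2'))
  exact_mod_cast (by omega : k + 2 ≤ r)

/-! ### Clique covers -/

theorem cliqueCoverNum_le_card {V : Type} [Finite V] {G : SimpleGraph V} (C : Finset (Set V))
    (hC : ∀ K ∈ C, G.IsClique K) (hcov : ∀ v : V, ∃ K ∈ C, v ∈ K) :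
    cliqueCoverNum G ≤ C.card :=
  Nat.sInf_le ⟨C, rfl, hC, hcov⟩

theorem exists_card_eq_cliqueCoverNum {V : Type} [Finite V] (G : SimpleGraph V) :
    ∃ C : Finset (Set V), C.card = cliqueCoverNum G ∧ (∀ K ∈ C, G.IsClique K) ∧
      ∀ v : V, ∃ K ∈ C, v ∈ K := by
  classical
  have := Fintype.ofFinite V
  refine Nat.sInf_mem (s := {n : ℕ | ∃ C : Finset (Set V),
    C.card = n ∧ (∀ K ∈ C, G.IsClique K) ∧ ∀ v : V, ∃ K ∈ C, v ∈ K})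
    ⟨_, univ.image (fun v : V => ({v} : Set V)), rfl, ?_, fun v => ⟨{v}, by simp, rfl⟩⟩
  intro K hK
  obtain ⟨v, -, rfl⟩ := mem_image.1 hK
  exact Set.pairwise_singleton _ _

theorem colorable_compl_cliqueCoverNum {V : Type} [Finite V] (G : SimpleGraph V) :
    Gᶜ.Colorable (cliqueCoverNum G) := by
  obtain ⟨C, hcard, hC, hcov⟩ := exists_card_eq_cliqueCoverNum G
  choose K hK hv using hcov
  let c : Gᶜ.Coloring C := SimpleGraph.Coloring.mk (fun v => ⟨K v, hK v⟩) (by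
    intro v w hvw h
    rw [SimpleGraph.compl_adj] at hvw
    have h' : K v = K w := congrArg Subtype.val h
    exact hvw.2 (hC _ (hK v) (hv v) (h' ▸ hv w) hvw.1))
  have := c.colorable
  rwa [Fintype.card_coe, hcard] at this

/-- If `U` is a maximum stable subset of `U ∪ W`, then a stable set `W` disjoint from `U`
can be matched into `U`. -/
theorem exists_matching_of_maximum {V : Type} [DecidableEq V] {G : SimpleGraph V} {U W : Finset V}
    (hU : G.IsIndepSet U) (hW : G.IsIndepSet W) (hdisj : Disjoint U W)
    (hmax : ∀ S : Finset V, S ⊆ U ∪ W → G.IsIndepSet S → S.card ≤ U.card) :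
    ∃ f : W → V, Function.Injective f ∧ ∀ w, f w ∈ U ∧ G.Adj w (f w) := by
  classical
  have := (Finset.all_card_le_biUnion_card_iff_exists_injective
    (fun w : W => U.filter fun u => G.Adj w u)).1 ?_
  · obtain ⟨f, hf, h⟩ := this
    exact ⟨f, hf, fun w => mem_filter.1 (h w)⟩
  -- Hall's condition: with `N` the neighbours of `S` in `U`, the set `(U \ N) ∪ S` is stable, so
  -- maximality gives `|S| ≤ |N|`.
  intro S
  set N := S.biUnion fun w : W => U.filter fun u => G.Adj w u with hN
  have hNU : N ⊆ U := biUnion_subset.2 fun _ _ => filter_subset _ _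
  have hSW : S.map (Function.Embedding.subtype _) ⊆ W := by
    intro x hx
    obtain ⟨w, -, rfl⟩ := mem_map.1 hx
    exact w.2
  have hadj : ∀ x ∈ U \ N, ∀ y ∈ S.map (Function.Embedding.subtype _), ¬ G.Adj y x := by
    intro x hx y hy h
    obtain ⟨w, hw, rfl⟩ := mem_map.1 hy
    exact (mem_sdiff.1 hx).2 (mem_biUnion.2 ⟨w, hw, mem_filter.2 ⟨(mem_sdiff.1 hx).1, h⟩⟩)
  have hle := hmax (U \ N ∪ S.map (Function.Embedding.subtype _))
    (union_subset_union sdiff_subset hSW) (by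
      intro x hx y hy hne
      rw [mem_coe, mem_union] at hx hy
      rcases hx with hx | hx <;> rcases hy with hy | hy
      · exact hU (mem_sdiff.1 hx).1 (mem_sdiff.1 hy).1 hne
      · exact fun h => hadj x hx y hy h.symm
      · exact hadj y hy x hx
      · exact hW (hSW hx) (hSW hy) hne)
  rw [card_union_of_disjoint (disjoint_of_subset_left sdiff_subset
    (disjoint_of_subset_right hSW hdisj)), card_map, card_sdiff_of_subset hNU] at hle
  have := card_le_card hNU
  omega

/-- A form of König's theorem: if all vertices outside `R` are covered by two stable sets, then
the clique cover number exceeds the stability number by at most `|R|`. -/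
theorem cliqueCoverNum_le_indepNum_add_card {V : Type} [Finite V] {G : SimpleGraph V}
    {A B R : Finset V} (hA : G.IsIndepSet A) (hB : G.IsIndepSet B)
    (hcov : ∀ v, v ∈ A ∨ v ∈ B ∨ v ∈ R) : cliqueCoverNum G ≤ G.indepNum + R.card := by
  classical
  have := Fintype.ofFinite V
  obtain ⟨U, hU, hmax⟩ := exists_max_image
    ((A ∪ B).powerset.filter fun S : Finset V => G.IsIndepSet (S : Set V)) card
    ⟨∅, by simp⟩
  simp only [mem_filter, mem_powerset] at hU hmax
  obtain ⟨hUAB, hUi⟩ := hU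
  have key : ∀ W : Finset V, W ⊆ A ∪ B → G.IsIndepSet W → Disjoint U W →
      ∃ f : W → V, Function.Injective f ∧ ∀ w, f w ∈ U ∧ G.Adj w (f w) := fun W hW hWi hd =>
    exists_matching_of_maximum hUi hWi hd fun S hS hSi =>
      hmax S ⟨hS.trans (union_subset hUAB hW), hSi⟩
  obtain ⟨f, hf, hfU⟩ := key (A \ U) (sdiff_subset.trans subset_union_left)
    (hA.mono (by simp)) disjoint_sdiff
  obtain ⟨g, hg, hgU⟩ := key (B \ U) (sdiff_subset.trans subset_union_right)
    (hB.mono (by simp)) disjoint_sdiff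
  -- the clique attached to `u ∈ U` has at most one vertex outside `U`
  let K : V → Set V := fun u => {v | v = u ∨ (u ∈ B ∧ ∃ w, f w = u ∧ (w : V) = v) ∨
    (u ∉ B ∧ ∃ w, g w = u ∧ (w : V) = v)}
  -- The two matchings have disjoint images, one inside `B` and one outside, so each `u` acquires at
  -- most one partner and `K u` is a vertex or an edge.
  have hfB : ∀ w, f w ∈ B := by
    intro w
    rcases mem_union.1 (hUAB (hfU w).1) with h | h
    · exact absurd (hfU w).2 (hA (mem_sdiff.1 w.2).1 h (hfU w).2.ne)
    · exact h
  have hgB : ∀ w, g w ∉ B := by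
    intro w h
    exact absurd (hgU w).2 (hB (mem_sdiff.1 w.2).1 h (hgU w).2.ne)
  have hKc : ∀ u, G.IsClique (K u) := by
    rintro u x (rfl | ⟨hb, w, hw, rfl⟩ | ⟨hb, w, hw, rfl⟩) y
      (rfl | ⟨hb', w', hw', rfl⟩ | ⟨hb', w', hw', rfl⟩) hne
    · exact absurd rfl hne
    · exact (hw' ▸ (hfU w').2).symm
    · exact (hw' ▸ (hgU w').2).symm
    · exact hw ▸ (hfU w).2
    · exact absurd (congrArg Subtype.val (hf (hw.trans hw'.symm))) hne
    · exact absurd hb hb'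
    · exact hw ▸ (hgU w).2
    · exact absurd hb' hb
    · exact absurd (congrArg Subtype.val (hg (hw.trans hw'.symm))) hne
  have hUα : U.card ≤ G.indepNum := SimpleGraph.IsIndepSet.card_le_indepNum (t := U) (tc := hUi)
  calc cliqueCoverNum G ≤ (U.image K ∪ R.image fun v => ({v} : Set V)).card := by
        refine cliqueCoverNum_le_card _ ?_ ?_
        · intro L hL
          rcases mem_union.1 hL with hL | hL
          · obtain ⟨u, -, rfl⟩ := mem_image.1 hL
            exact hKc u
          · obtain ⟨u, -, rfl⟩ := mem_image.1 hL
            exact Set.pairwise_singleton _ _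
        · intro v
          by_cases hvU : v ∈ U
          · exact ⟨K v, mem_union_left _ (mem_image_of_mem _ hvU), Or.inl rfl⟩
          rcases hcov v with hv | hv | hv
          · let w : ↥(A \ U) := ⟨v, mem_sdiff.2 ⟨hv, hvU⟩⟩
            exact ⟨K (f w), mem_union_left _ (mem_image_of_mem _ (hfU w).1),
              Or.inr (Or.inl ⟨hfB w, w, rfl, rfl⟩)⟩
          · let w : ↥(B \ U) := ⟨v, mem_sdiff.2 ⟨hv, hvU⟩⟩
            exact ⟨K (g w), mem_union_left _ (mem_image_of_mem _ (hgU w).1),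
              Or.inr (Or.inr ⟨hgB w, w, rfl, rfl⟩)⟩
          · exact ⟨{v}, mem_union_right _ (mem_image_of_mem _ hv), rfl⟩
    _ ≤ U.card + R.card := (card_union_le _ _).trans (add_le_add card_image_le card_image_le)
    _ ≤ _ := by omega

/-! ### Clique covers of induced subgraphs of Schrijver graphs -/

theorem val_finRotate {m : ℕ} (i : Fin m) : (finRotate m i : ℕ) = ((i : ℕ) + 1) % m := by
  cases m with
  | zero => exact i.elim0
  | succ m => simp [finRotate_apply, Fin.val_add]

/-- The positions `i` such that neither `i` nor its successor lies in `S`. -/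
def gaps {m : ℕ} (S : Finset (Fin m)) : Finset (Fin m) :=
  univ.filter fun i => i ∉ S ∧ finRotate m i ∉ S

theorem IsSparse.finRotate_notMem {m : ℕ} {S : Finset (Fin m)} (hS : IsSparse S) {i : Fin m}
    (hi : i ∈ S) : finRotate m i ∉ S :=
  fun h => hS i hi _ h (val_finRotate i)

theorem IsSparse.card_gaps {m : ℕ} {S : Finset (Fin m)} (hS : IsSparse S) :
    (gaps S).card + 2 * S.card = m := by
  have h1 : (univ.filter fun i => finRotate m i ∈ S) = S.map (finRotate m).symm.toEmbedding := by
    ext i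
    simp [mem_map_equiv]
  have h2 : Disjoint S (univ.filter fun i => finRotate m i ∈ S) :=
    disjoint_left.2 fun i hi h => hS.finRotate_notMem hi (mem_filter.1 h).2
  have h3 : gaps S = (S ∪ univ.filter fun i => finRotate m i ∈ S)ᶜ := by
    ext i
    simp [gaps]
  rw [h3, card_compl, card_union_of_disjoint h2, h1, card_map, Fintype.card_fin]
  have := card_le_univ (S ∪ univ.filter fun i => finRotate m i ∈ S)
  rw [card_union_of_disjoint h2, h1, card_map, Fintype.card_fin] at this
  omega

theorem mul_cliqueCoverNum_induce_schrijverGraph_le {n : ℕ} (hn : 1 ≤ n) (k : ℕ)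
    (s : Set {S : {S : Finset (Fin (2 * n + k)) // S.card = n} | IsSparse S.1}) :
    n * cliqueCoverNum ((schrijverGraph n k).induce s) ≤
      (n + k) * ((schrijverGraph n k).induce s).indepNum := by
  classical
  have := Fintype.ofFinite s
  set H := (schrijverGraph n k).induce s
  let P : Fin (2 * n + k) → Finset s := fun i => univ.filter fun v => i ∈ v.1.1.1
  let R : Fin (2 * n + k) → Finset s := fun i => univ.filter fun v => i ∈ gaps v.1.1.1
  have hP : ∀ i, H.IsIndepSet (P i) := by
    intro i v hv w hw _ h
    exact disjoint_left.1 h.2 (mem_filter.1 hv).2 (mem_filter.1 hw).2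
  have hcov : ∀ i (v : s), v ∈ P i ∨ v ∈ P (finRotate _ i) ∨ v ∈ R i := by
    intro i v
    simp only [P, R, gaps, mem_filter, mem_univ, true_and]
    tauto
  have hPα : ∀ i, (P i).card ≤ H.indepNum := fun i =>
    SimpleGraph.IsIndepSet.card_le_indepNum (t := P i) (tc := hP i)
  have hcard : ∀ i, Fintype.card s ≤ 2 * H.indepNum + (R i).card := by
    intro i
    have h : (univ : Finset s) ⊆ P i ∪ (P (finRotate _ i) ∪ R i) := fun v _ => by
      simpa only [mem_union] using hcov i v
    have h1 := card_le_card h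
    have h2 := card_union_le (P i) (P (finRotate _ i) ∪ R i)
    have h3 := card_union_le (P (finRotate _ i)) (R i)
    have h4 := hPα i
    have h5 := hPα (finRotate _ i)
    rw [card_univ] at h1
    omega
  have hsum : ∑ i, (R i).card = k * Fintype.card s := by
    have h : ∑ i, (R i).card = ∑ v : s, (gaps v.1.1.1).card := by
      simp only [R, card_filter]
      rw [sum_comm]
      refine sum_congr rfl fun v _ => ?_
      rw [← card_filter, filter_mem_eq_inter, univ_inter]
    rw [h, sum_congr rfl fun v _ => ?_, sum_const, card_univ, smul_eq_mul, mul_comm]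
    have := IsSparse.card_gaps v.1.2
    rw [v.1.1.2] at this
    omega
  obtain ⟨i, hi⟩ : ∃ i, (2 * n + k) * (R i).card ≤ k * Fintype.card s := by
    by_contra! hlt
    have : ∑ _i : Fin (2 * n + k), k * Fintype.card s <
        ∑ i : Fin (2 * n + k), (2 * n + k) * (R i).card :=
      sum_lt_sum_of_nonempty ⟨⟨0, by omega⟩, mem_univ _⟩ fun i _ => hlt i
    rw [← mul_sum (f := fun i => (R i).card), hsum, sum_const, card_univ, Fintype.card_fin,
      smul_eq_mul] at this
    exact lt_irrefl _ this
  -- Substitute `|s| ≤ 2α + |R i|` into the averaged bound and cancel `k|R i|`, then a factor of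
  -- two.
  have hR : n * (R i).card ≤ k * H.indepNum := by
    have := Nat.mul_le_mul_left k (hcard i)
    nlinarith
  calc n * cliqueCoverNum H ≤ n * (H.indepNum + (R i).card) :=
        Nat.mul_le_mul_left n (cliqueCoverNum_le_indepNum_add_card (hP i) (hP _) (hcov i))
    _ ≤ _ := by nlinarith

/-- Membership propagates around the cycle: the successor of a member is absent, and the successor
of a nonmember is present unless there is a gap. The gaps and one bit thus encode a vertex, which
bounds the number of vertices. -/
theorem eq_of_gaps_eq {m : ℕ} {S S' : Finset (Fin m)} (hS : IsSparse S) (hS' : IsSparse S')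
    (hg : gaps S = gaps S') (h0 : ∀ i : Fin m, (i : ℕ) = 0 → (i ∈ S ↔ i ∈ S')) : S = S' := by
  have key : ∀ j (hj : j < m), (⟨j, hj⟩ ∈ S ↔ ⟨j, hj⟩ ∈ S') := by
    intro j
    induction j with
    | zero => exact fun hj => h0 _ rfl
    | succ j ih =>
      intro hj
      have hi := ih (by omega)
      have hrot : finRotate m ⟨j, by omega⟩ = ⟨j + 1, hj⟩ := by
        ext
        rw [val_finRotate, Nat.mod_eq_of_lt hj]
      have h1 : (⟨j, by omega⟩ : Fin m) ∈ gaps S ↔ (⟨j, by omega⟩ : Fin m) ∈ gaps S' := by rw [hg]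
      simp only [gaps, mem_filter, mem_univ, true_and, hrot] at h1
      have h2 := hS.finRotate_notMem (i := ⟨j, by omega⟩)
      have h3 := hS'.finRotate_notMem (i := ⟨j, by omega⟩)
      rw [hrot] at h2 h3
      tauto
  ext ⟨j, hj⟩
  exact key j hj

theorem natCard_schrijverGraph_vertices_le {n k : ℕ} (hn : k + 3 ≤ n) :
    Nat.card {S : {S : Finset (Fin (2 * n + k)) // S.card = n} | IsSparse S.1} ≤
      n ^ (2 * k + 1) := by
  classical
  let F : {S : {S : Finset (Fin (2 * n + k)) // S.card = n} | IsSparse S.1} →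
      Bool × (powersetCard k (univ : Finset (Fin (2 * n + k)))) := fun S =>
    (decide (⟨0, by omega⟩ ∈ S.1.1), ⟨gaps S.1.1, mem_powersetCard.2 ⟨subset_univ _, by
      have := IsSparse.card_gaps S.2
      rw [S.1.2] at this
      omega⟩⟩)
  have hF : Function.Injective F := by
    intro S S' h
    simp only [F, Prod.mk.injEq, Subtype.mk.injEq, decide_eq_decide] at h
    refine Subtype.ext (Subtype.ext (eq_of_gaps_eq S.2 S'.2 h.2 ?_))
    rintro ⟨i, hi⟩ rfl
    exact h.1
  have h1 := Nat.card_le_card_of_injective F hF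
  rw [Nat.card_prod, Nat.card_eq_fintype_card (α := Bool), Fintype.card_bool,
    Nat.card_eq_fintype_card (α := powersetCard k _), Fintype.card_coe, card_powersetCard, card_univ, Fintype.card_fin] at h1
  calc _ ≤ 2 * (2 * n + k).choose k := h1
    _ ≤ n * (n ^ 2) ^ k := Nat.mul_le_mul (by omega)
        ((Nat.choose_le_pow _ _).trans (Nat.pow_le_pow_left (by nlinarith) k))
    _ = n ^ (2 * k + 1) := by rw [← pow_mul, pow_succ, mul_comm]

theorem thetaBoundedBy_schrijverGraph {h : ℕ → ℝ} (hmono : ∀ m n : ℕ, 1 ≤ m → m ≤ n → h m ≤ h n)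
    (hone : 0 ≤ h 1) (hpos : ∀ n : ℕ, 2 ≤ n → 0 < h n) {n k : ℕ} (hn : k + 3 ≤ n)
    (hh : h (n ^ (2 * k + 1)) ≤ (n : ℝ) / ((2 * k + 1 : ℕ) : ℝ)) :
    ThetaBoundedBy (schrijverGraph n k) (fun x : ℕ => (x : ℝ) + (x : ℝ) / h x) := by
  intro s
  have hle := mul_cliqueCoverNum_induce_schrijverGraph_le (by omega : 1 ≤ n) k s
  have hcard : ((schrijverGraph n k).induce s).indepNum ≤ n ^ (2 * k + 1) := by
    classical
    obtain ⟨t, ht⟩ := SimpleGraph.exists_isNIndepSet_indepNum (G := (schrijverGraph n k).induce s)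
    rw [← ht.card_eq]
    have := Fintype.ofFinite s
    calc t.card ≤ Nat.card s := by rw [Nat.card_eq_fintype_card]; exact card_le_univ t
      _ ≤ _ := Nat.card_le_card_of_injective _ Subtype.val_injective
      _ ≤ _ := natCard_schrijverGraph_vertices_le hn
  generalize ((schrijverGraph n k).induce s).indepNum = α at hle hcard
  generalize cliqueCoverNum ((schrijverGraph n k).induce s) = θ at hle
  change (θ : ℝ) ≤ (α : ℝ) + (α : ℝ) / h α
  rcases Nat.eq_zero_or_pos α with rfl | hα
  · have : θ = 0 := by
      rw [mul_zero, Nat.le_zero, mul_eq_zero] at hle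
      omega
    simp [this]
  have hα0 : 0 ≤ h α := hone.trans (hmono 1 α le_rfl hα)
  -- `h α = 0` is possible only at `α = 1`, where division by zero gives `f(1) = 1`; there `nθ ≤ n +
  -- k < 2n` forces `θ ≤ 1`.
  rcases hα0.eq_or_lt with h0 | h0
  · have h1 : α = 1 := by
      by_contra hne
      exact absurd (hpos α (by omega)) (by rw [← h0]; exact lt_irrefl _)
    subst h1
    have : θ ≤ 1 := by
      by_contra! h2
      have := Nat.mul_le_mul_left n h2
      simp only [Nat.succ_eq_add_one] at this
      omega
    rw [← h0]
    simpa using this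
  · have hn0 : (0 : ℝ) < n := by exact_mod_cast (by omega : 0 < n)
    have hk : (k : ℝ) * h α ≤ n := by
      have h1 := (hmono α _ hα hcard).trans hh
      rw [le_div_iff₀ (by positivity)] at h1
      push_cast at h1
      nlinarith [(k.cast_nonneg : (0 : ℝ) ≤ k)]
    have hle' : (n : ℝ) * θ ≤ (n + k) * α := by exact_mod_cast hle
    have h2 : (k : ℝ) * α / n ≤ α / h α := by
      rw [div_le_div_iff₀ hn0 h0]
      nlinarith [(α.cast_nonneg : (0 : ℝ) ≤ α)]
    have h3 : (θ : ℝ) ≤ (n + k) * α / n := by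
      rw [le_div_iff₀ hn0]
      linarith
    have h4 : ((n : ℝ) + k) * α / n = α + k * α / n := by
      field_simp
    linarith

/-! ### Colourings and complements -/

theorem cliqueFree_three_schrijverGraph {n k : ℕ} (h : k < n) :
    (schrijverGraph n k).CliqueFree 3 := by
  classical
  intro t ht
  obtain ⟨A, B, C, hAB, hAC, hBC, -⟩ := SimpleGraph.is3Clique_iff.1 ht
  have h1 : Disjoint A.1.1 B.1.1 := hAB.2
  have h2 : Disjoint A.1.1 C.1.1 := hAC.2
  have h3 : Disjoint B.1.1 C.1.1 := hBC.2
  have := card_le_univ (A.1.1 ∪ B.1.1 ∪ C.1.1)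
  rw [card_union_of_disjoint (disjoint_union_left.2 ⟨h2, h3⟩), card_union_of_disjoint h1,
    A.1.2, B.1.2, C.1.2, Fintype.card_fin] at this
  omega

theorem cliqueNum_induce_schrijverGraph_le {n k : ℕ} (h : k < n)
    (s : Set {S : {S : Finset (Fin (2 * n + k)) // S.card = n} | IsSparse S.1}) :
    ((schrijverGraph n k).induce s).cliqueNum ≤ 2 := by
  by_contra! hlt
  obtain ⟨t, ht⟩ := SimpleGraph.exists_isNClique_cliqueNum (G := (schrijverGraph n k).induce s)
  exact ((cliqueFree_three_schrijverGraph h).comap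
    ⟨(SimpleGraph.Embedding.induce s).toCopy⟩).mono hlt t ht

theorem le_of_colorable_induce_univ_schrijverGraph {n k r : ℕ} (hn : 1 ≤ n)
    (h : ((schrijverGraph n k).induce Set.univ).Colorable r) : k + 2 ≤ r := by
  have h' : (schrijverGraph n k).Colorable r :=
    h.of_hom (SimpleGraph.induceUnivIso _).symm.toHom
  exact_mod_cast (le_chromaticNumber_schrijverGraph hn k).trans h'.chromaticNumber_le

theorem induce_compl_eq {V : Type*} (G : SimpleGraph V) (s : Set V) :
    Gᶜ.induce s = (G.induce s)ᶜ := by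
  ext v w
  simp [SimpleGraph.compl_adj, Subtype.ext_iff]

theorem toNat_chromaticNumber_le {V : Type*} {G : SimpleGraph V} {r : ℕ} (h : G.Colorable r) :
    G.chromaticNumber.toNat ≤ r :=
  ENat.toNat_le_of_le_natCast h.chromaticNumber_le

theorem ThetaBoundedBy.chiBoundedBy_compl {V : Type} [Finite V] {G : SimpleGraph V} {f : ℕ → ℝ}
    (h : ThetaBoundedBy G f) : ChiBoundedBy Gᶜ f := by
  intro s
  rw [induce_compl_eq, SimpleGraph.cliqueNum_compl]
  refine le_trans ?_ (h s)
  exact_mod_cast toNat_chromaticNumber_le (colorable_compl_cliqueCoverNum (G.induce s))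

theorem exists_forall_le_two_lt (g : ℕ → ℝ) : ∃ k : ℕ, ∀ c ≤ 2, g c < ((k + 2 : ℕ) : ℝ) := by
  obtain ⟨k, hk⟩ := exists_nat_gt (max (g 0) (max (g 1) (g 2)))
  refine ⟨k, fun c hc => ?_⟩
  simp only [max_lt_iff] at hk
  push_cast
  interval_cases c <;> linarith

theorem theorem4p7 (h : ℕ → ℝ)
    (hmono : ∀ m n : ℕ, 1 ≤ m → m ≤ n → h m ≤ h n)
    (hone : 0 ≤ h 1)
    (hpos : ∀ n : ℕ, 2 ≤ n → 0 < h n)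
    (hgrowth : ∀ k : ℕ, 1 ≤ k → ∃ n₀ : ℕ, ∀ n : ℕ, n₀ ≤ n → h (n ^ k) ≤ (n : ℝ) / (k : ℝ)) :
    ¬ ComplementaryBounded (fun x : ℕ => (x : ℝ) + (x : ℝ) / h x) ∧
    ∃ N : ℕ → ℕ,
      (∀ k : ℕ, 0 < N k) ∧
      (∀ k : ℕ, ThetaBoundedBy (schrijverGraph (N k) k)
        (fun x : ℕ => (x : ℝ) + (x : ℝ) / h x)) ∧
      (∀ m : ℕ, ∃ k : ℕ, (m : ℕ∞) ≤ (schrijverGraph (N k) k).chromaticNumber) ∧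
      (¬ ∃ g : ℕ → ℝ, ∀ k : ℕ, ChiBoundedBy (schrijverGraph (N k) k) g) := by
  choose n₀ hn₀ using fun k : ℕ => hgrowth (2 * k + 1) (by omega)
  -- The term `n₀ k` serves the growth condition at exponent `2k + 1`; `k + 3` serves the vertex
  -- count and excludes triangles.
  let N : ℕ → ℕ := fun k => max (n₀ k) (k + 3)
  have hN : ∀ k, k + 3 ≤ N k := fun k => le_max_right _ _
  have hθ : ∀ k : ℕ, ThetaBoundedBy (schrijverGraph (N k) k)
      (fun x : ℕ => (x : ℝ) + (x : ℝ) / h x) := fun k =>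
    thetaBoundedBy_schrijverGraph hmono hone hpos (hN k) (hn₀ k _ (le_max_left _ _))
  have hpos' : ∀ k, 1 ≤ N k := fun k => by have := hN k; omega
  have hω : ∀ k s, ((schrijverGraph (N k) k).induce s).cliqueNum ≤ 2 := fun k s =>
    cliqueNum_induce_schrijverGraph_le (by have := hN k; omega) s
  refine ⟨?_, N, hpos', hθ, fun m => ⟨m, ?_⟩, ?_⟩
  · rintro ⟨g, hg⟩
    obtain ⟨k, hk⟩ := exists_forall_le_two_lt g
    -- For the complement of the Schrijver graph, `θ` is at least `k + 2` and `α` is at most `2`,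
    -- against the choice of `k`.
    have h1 := hg _ _ (hθ k).chiBoundedBy_compl Set.univ
    rw [induce_compl_eq, SimpleGraph.indepNum_compl] at h1
    have h2 := colorable_compl_cliqueCoverNum ((schrijverGraph (N k) k).induce Set.univ)ᶜ
    rw [compl_compl] at h2
    have h3 : ((k + 2 : ℕ) : ℝ) ≤ _ :=
      Nat.cast_le.2 (le_of_colorable_induce_univ_schrijverGraph (hpos' k) h2)
    exact absurd (h3.trans h1) (not_le.2 (hk _ (hω k _)))
  · refine le_trans ?_ (le_chromaticNumber_schrijverGraph (hpos' m) m)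
    exact_mod_cast Nat.le_add_right m 2
  · rintro ⟨g, hg⟩
    obtain ⟨k, hk⟩ := exists_forall_le_two_lt g
    have h2 := ((schrijverGraph (N k) k).induce Set.univ).colorable_chromaticNumber_of_fintype
    have h3 : ((k + 2 : ℕ) : ℝ) ≤ _ :=
      Nat.cast_le.2 (le_of_colorable_induce_univ_schrijverGraph (hpos' k) h2)
    exact absurd (h3.trans (hg k Set.univ)) (not_le.2 (hk _ (hω k _)))
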